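/- Let $q\ge 1$ and $n\ge 0$ be integers. For $a\in\mathbb{Z}_q=\{0,\dots,q-1\}$ let $\mathrm{wt}(a)=\min(a,q-a)$ be its Lee weight, and for $\mathbf{x}\in\mathbb{Z}_q^n$ let $\mathrm{wt}(\mathbf{x})=\sum_{i=1}^n \mathrm{wt}(x_i)$. Let $\delta_q=\frac1q\sum_{a\in\mathbb{Z}_q}\mathrm{wt}(a)$. For $\beta\in\mathbb{R}$ let $B(e)=\frac{1}{Z(\beta)}\exp(-\beta\,\mathrm{wt}(e))$, with $Z(\beta)=\sum_{e\in\mathbb{Z}_q}\exp(-\beta\,\mathrm{wt}(e))$, be the Boltzmann distribution on $\mathbb{Z}_q$, and let $\delta=\sum_{e\in\mathbb{Z}_q}B(e)\,\mathrm{wt}(e)$ be its mean Lee weight. The memoryless Lee channel with parameter $\delta$ maps $\mathbf{x}\in\mathbb{Z}_q^n$ to $\mathbf{y}=\mathbf{x}+\mathbf{e}$, where the entries of $\mathbf{e}$ are independent with distribution $B$; thus $P(\mathbf{y}\mid\mathbf{x})=\prod_{i=1}^n B(y_i-x_i)$. Suppose that $\delta\le\delta_q$. (For $q\ge 2$ this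 covers every $\delta$ with $0<\delta\le\delta_q$, each of which comes from exactly one $\beta$, and $\beta\ge 0$.) Let $\mathcal{C}\subseteq\mathbb{Z}_q^n$ be a linear code, i.e. a $\mathbb{Z}_q$-submodule, and let $W_\ell^{(n)}(\mathcal{C})=|\{\mathbf{c}\in\mathcal{C}:\mathrm{wt}(\mathbf{c})=\ell\}|$ be its Lee weight enumerator. Consider any maximum likelihood decoder for $\mathcal{C}$: given $\mathbf{y}$, it outputs a codeword that maximizes $P(\mathbf{y}\mid\mathbf{x})$ over $\mathbf{x}\in\mathcal{C}$, and it breaks ties in an arbitrary way, deterministically or at random. Let $P_B(\mathcal{C})$ be its block error probability, i.e. the probability that the decoder's output differs from the transmitted codeword, when the latter is chosen uniformly at random in $\mathcal{C}$. Then $$P_B(\mathcal{C})\;\le\;\sum_{\ell=1}^{n\lfloor q/2\rfloor}W_\ell^{(n)}(\mathcal{C})\;\mathbb{P}\Big(\sum_{i=1}^{\min(\ell,n)}\Lambda_1^{(i)}\le 0\Big),$$ where $\Lambda_1^{(1)},\Lambda_1^{(2)},\dots$ are independent copies of the log-likelihood ratio $\Lambda_1=\log\frac{B(Y)}{B(Y-1)}$,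 with $Y$ distributed according to $B$. -/

import Mathlib

noncomputable section

/-- The Lee weight of `a ∈ ℤ/qℤ`, with `a` represented in `{0, …, q - 1}`. -/
def leeWeight {q : ℕ} (a : ZMod q) : ℕ := min a.val (q - a.val)

/-- The Lee weight of a vector: the sum of the Lee weights of its entries. -/
def leeWeightVec {q n : ℕ} (x : Fin n → ZMod q) : ℕ := ∑ i, leeWeight (x i)

/-- `δ_q`: the expected Lee weight of a uniformly distributed element of `ℤ/qℤ`. -/
def uniformLeeWeight (q : ℕ) [NeZero q] : ℝ := (∑ a : ZMod q, (leeWeight a : ℝ)) / q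

/-- The normalization constant `Z(β)`. -/
def boltzmannZ (q : ℕ) [NeZero q] (β : ℝ) : ℝ :=
  ∑ e : ZMod q, Real.exp (-β * leeWeight e)

/-- The Boltzmann distribution `P_E(e) = exp (-β wt(e)) / Z(β)` on `ℤ/qℤ`. -/
def boltzmann (q : ℕ) [NeZero q] (β : ℝ) (e : ZMod q) : ℝ :=
  Real.exp (-β * leeWeight e) / boltzmannZ q β

/-- The expected Lee weight of a Boltzmann distributed element of `ℤ/qℤ`. -/
def boltzmannMean (q : ℕ) [NeZero q] (β : ℝ) : ℝ :=
  ∑ e : ZMod q, boltzmann q β e * leeWeight e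

/-- Transition probability `P(y | x)` of the memoryless Lee channel `y = x + e`
for a single symbol. -/
def leeChannel (q : ℕ) [NeZero q] (β : ℝ) (y x : ZMod q) : ℝ := boltzmann q β (y - x)

/-- Transition probability of the memoryless Lee channel for words of length `n`. -/
def leeChannelVec (q : ℕ) [NeZero q] {n : ℕ} (β : ℝ) (y x : Fin n → ZMod q) : ℝ :=
  ∏ i, leeChannel q β (y i) (x i)

/-- The log-likelihood ratio `Λ(y, c) = log (P(y | 0) / P(y | c))`. -/
def logLikelihoodRatio (q : ℕ) [NeZero q] (β : ℝ) (y c : ZMod q) : ℝ :=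
  Real.log (leeChannel q β y 0 / leeChannel q β y c)

open Classical in
/-- The probability that the sum of `m` independent copies of `Λ₁ = Λ(Y, 1)`, with `Y`
Boltzmann distributed, is at most `0`. -/
def probSumLLRNonpos (q : ℕ) [NeZero q] (β : ℝ) (m : ℕ) : ℝ :=
  ∑ y : Fin m → ZMod q,
    if ∑ i, logLikelihoodRatio q β (y i) 1 ≤ 0 then ∏ i, boltzmann q β (y i) else 0

/-- The Lee weight enumerator: the number of codewords of Lee weight `l`. -/
def leeWeightEnumerator {q n : ℕ} (C : Submodule (ZMod q) (Fin n → ZMod q)) (l : ℕ) : ℕ :=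
  Set.ncard {c : Fin n → ZMod q | c ∈ C ∧ leeWeightVec c = l}

/-- `D` is a maximum likelihood decoder for the code `C`: given the received word `y`, it outputs
a codeword that maximizes the likelihood `P(y | ·)` over `C`. Ties may be broken in any way,
deterministically or at random: `D y` is the law of the output. -/
def IsMLDecoder (q : ℕ) [NeZero q] {n : ℕ} (β : ℝ) (C : Submodule (ZMod q) (Fin n → ZMod q))
    (D : (Fin n → ZMod q) → PMF (Fin n → ZMod q)) : Prop :=
  ∀ y, ∀ x ∈ (D y).support, x ∈ C ∧ ∀ x' ∈ C, leeChannelVec q β y x' ≤ leeChannelVec q β y x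

open Classical in
/-- The block error probability of the code `C` with decoder `D`: a codeword `x`, chosen uniformly
at random in `C`, is sent, the channel outputs `y`, and the decoder's output differs from `x`. -/
def blockErrorProb (q : ℕ) [NeZero q] {n : ℕ} (β : ℝ) (C : Submodule (ZMod q) (Fin n → ZMod q))
    (D : (Fin n → ZMod q) → PMF (Fin n → ZMod q)) : ℝ :=
  (Nat.card C : ℝ)⁻¹ * ∑ x : Fin n → ZMod q,
    if x ∈ C then ∑ y : Fin n → ZMod q, leeChannelVec q β y x * (1 - (D y x).toReal) else 0

end

/-! ### Geometry of the Lee weight on the cycle of length `q` -/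

section LeeWeight

/-! Given the output `y`, a maximum likelihood decoder keeps exactly the largest likelihood, however
ties fall. A sum without its largest term is at most half the sum of the minima over ordered pairs
of distinct indices. With translation invariance this bounds the block error probability by half the
sum of `overlap q β c 1 1` over the nonzero codewords (`blockErrorProb_le_sum_overlap`).

The core is that replacing `c` by an all-one word of length `leeWeightVec c` can only increase the
overlap. One symbol with shift `w + 1 ≤ q / 2` is at least as easy to tell from `0` as two
independent symbols with shifts `w` and `1` (`shiftAverage_succ_min_le`). This is proved for all
nonnegative prior weights, because the other symbols of a word turn the priors into arbitrary
likelihoods; words are then handled one symbol at a time through the commuting operators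
`shiftAverage`. The comparison fails term by term, but holds after summing over the orbits of the
reflections `e ↦ 1 - e` and `z ↦ 1 - z` (`symmCouplingGap_nonneg`). It needs `β ≥ 0`, which the
bound on the mean supplies.

Fewer observations can only increase the overlap, so the length may be lowered to the minimum of the
weight and `n`. For an all-one word, the reflection `y ↦ 1 - y` exchanges the hypotheses and bounds
the overlap by twice the probability of a nonpositive log-likelihood sum (`overlap_const_one_le`).
-/

theorem leeWeight_zero {q : ℕ} : leeWeight (0 : ZMod q) = 0 := by simp [leeWeight]

variable {q : ℕ} [NeZero q]

theorem leeWeight_natCast {k : ℕ} (hk : k ≤ q) : leeWeight (k : ZMod q) = min k (q - k) := by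
  rcases hk.lt_or_eq with h | rfl
  · rw [leeWeight, ZMod.val_natCast, Nat.mod_eq_of_lt h]
  · simp [leeWeight_zero]

theorem leeWeight_neg (a : ZMod q) : leeWeight (-a) = leeWeight a := by
  have ha := ZMod.val_lt a
  by_cases h : a = 0
  · rw [h, neg_zero]
  · have : NeZero a := ⟨h⟩
    rw [leeWeight, leeWeight, ZMod.val_neg_of_ne_zero]
    omega

theorem leeWeight_sub_comm (a b : ZMod q) : leeWeight (a - b) = leeWeight (b - a) := by
  rw [← leeWeight_neg, neg_sub]

theorem leeWeight_intCast {i : ℤ} (h₁ : -q ≤ i) (h₂ : i ≤ q) :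
    (leeWeight (i : ZMod q) : ℤ) = min |i| (q - |i|) := by
  rcases le_total 0 i with h | h
  · lift i to ℕ using h
    rw [Int.cast_natCast, leeWeight_natCast (by omega)]
    simp only [Nat.abs_cast]
    omega
  · obtain ⟨k, rfl⟩ : ∃ k : ℕ, i = -k := ⟨i.natAbs, by omega⟩
    rw [Int.cast_neg, Int.cast_natCast, leeWeight_neg, leeWeight_natCast (by omega)]
    simp only [abs_neg, Nat.abs_cast]
    omega

theorem leeWeight_le_half (a : ZMod q) : leeWeight a ≤ q / 2 := by
  have := ZMod.val_lt a
  rw [leeWeight]; omega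

theorem leeWeight_eq_zero {a : ZMod q} : leeWeight a = 0 ↔ a = 0 := by
  have := ZMod.val_lt a
  rw [← ZMod.val_eq_zero, leeWeight]; omega

theorem exists_int_rep (e : ZMod q) : ∃ k : ℤ, 0 ≤ k ∧ k < q ∧ (k : ZMod q) = e :=
  ⟨e.val, by positivity, by exact_mod_cast ZMod.val_lt e, by simp⟩

theorem leeWeight_sub_one_trichotomy (e : ZMod q) :
    leeWeight e = leeWeight (e - 1) + 1 ∨ leeWeight (e - 1) = leeWeight e + 1 ∨
      leeWeight e = leeWeight (e - 1) := by
  obtain ⟨k, h0, hq, rfl⟩ := exists_int_rep e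
  have h1 := leeWeight_intCast (q := q) (i := k) (by omega) (by omega)
  have h2 := leeWeight_intCast (q := q) (i := k - 1) (by omega) (by omega)
  push_cast at h2
  rcases abs_cases (k : ℤ) with h | h <;> rcases abs_cases (k - 1 : ℤ) with h' | h' <;> omega

/-- If `e` is closer to `1` than to `0`, then `e + w` is farther from `0` than the mirror image
`1 - e + w`. -/
theorem leeWeight_reflect_add_lt {w : ℕ} (hw : w + 1 ≤ q / 2) {e : ZMod q}
    (he : leeWeight e = leeWeight (e - 1) + 1) :
    leeWeight (1 - e + (w : ZMod q)) + 1 ≤ leeWeight (e + (w : ZMod q)) := by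
  obtain ⟨k, h0, hq, rfl⟩ := exists_int_rep e
  have h1 := leeWeight_intCast (q := q) (i := k) (by omega) (by omega)
  have h2 := leeWeight_intCast (q := q) (i := k - 1) (by omega) (by omega)
  push_cast at h2
  -- Being closer to `1` puts `e` on the half of the cycle that starts at `1`.
  have hk : 1 ≤ k ∧ 2 * k ≤ q := by
    rcases abs_cases (k : ℤ) with h | h <;> rcases abs_cases (k - 1 : ℤ) with h' | h' <;> omega
  have h3 := leeWeight_intCast (q := q) (i := 1 - k + w) (by omega) (by omega)
  have h4 := leeWeight_intCast (q := q) (i := k + w) (by omega) (by omega)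
  push_cast at h3 h4
  rcases abs_cases (k + w : ℤ) with h | h <;> rcases abs_cases (1 - k + w : ℤ) with h' | h' <;>
    omega

theorem leeWeight_add_lt_of_eq {w : ℕ} (hw₁ : 1 ≤ w) (hw : w + 1 ≤ q / 2) {e : ZMod q}
    (he : leeWeight e = leeWeight (e - 1)) : leeWeight (e + (w : ZMod q)) + 1 ≤ leeWeight e := by
  obtain ⟨k, h0, hq, rfl⟩ := exists_int_rep e
  have h1 := leeWeight_intCast (q := q) (i := k) (by omega) (by omega)
  have h2 := leeWeight_intCast (q := q) (i := k - 1) (by omega) (by omega)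
  push_cast at h2
  -- A tie occurs only at the point opposite the edge from `0` to `1`, with `q` odd; moving on by
  -- `w` from there approaches `0`.
  have hk : 2 * k = q + 1 := by
    rcases abs_cases (k : ℤ) with h | h <;> rcases abs_cases (k - 1 : ℤ) with h' | h' <;> omega
  have h4 := leeWeight_intCast (q := q) (i := k + w) (by omega) (by omega)
  push_cast at h4
  rcases abs_cases (k + w : ℤ) with h | h <;> rcases abs_cases (k : ℤ) with h' | h' <;> omega

end LeeWeight

/-! ### The Boltzmann distribution and the sign of `β` -/

section Boltzmann

variable {q : ℕ} [NeZero q] {β : ℝ}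

theorem boltzmannZ_pos : 0 < boltzmannZ q β :=
  Finset.sum_pos (fun _ _ => Real.exp_pos _) Finset.univ_nonempty

theorem boltzmann_pos (e : ZMod q) : 0 < boltzmann q β e :=
  div_pos (Real.exp_pos _) boltzmannZ_pos

theorem sum_boltzmann : ∑ e : ZMod q, boltzmann q β e = 1 := by
  simp only [boltzmann]
  rw [← Finset.sum_div]
  exact div_self boltzmannZ_pos.ne'

theorem boltzmann_congr {a b : ZMod q} (h : leeWeight a = leeWeight b) :
    boltzmann q β a = boltzmann q β b := by rw [boltzmann, boltzmann, h]

theorem boltzmann_sub_comm (a b : ZMod q) : boltzmann q β (a - b) = boltzmann q β (b - a) :=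
  boltzmann_congr (leeWeight_sub_comm a b)

theorem boltzmann_neg (a : ZMod q) : boltzmann q β (-a) = boltzmann q β a :=
  boltzmann_congr (leeWeight_neg a)

theorem boltzmann_of_leeWeight_eq_succ {a b : ZMod q} (h : leeWeight a = leeWeight b + 1) :
    boltzmann q β a = Real.exp (-β) * boltzmann q β b := by
  rw [boltzmann, boltzmann, h, mul_div_assoc', ← Real.exp_add]
  push_cast
  ring_nf

theorem boltzmann_le_of_leeWeight_lt (hβ : 0 ≤ β) {a b : ZMod q}
    (h : leeWeight b + 1 ≤ leeWeight a) :
    boltzmann q β a ≤ Real.exp (-β) * boltzmann q β b := by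
  rw [boltzmann, boltzmann, mul_div_assoc', ← Real.exp_add]
  refine div_le_div_of_nonneg_right (Real.exp_le_exp.2 ?_) boltzmannZ_pos.le
  have : (leeWeight b : ℝ) + 1 ≤ leeWeight a := by exact_mod_cast h
  nlinarith

/-- A mean Lee weight that does not exceed the uniform one forces `β ≥ 0`. -/
theorem nonneg_of_boltzmannMean_le (hq : 2 ≤ q) (h : boltzmannMean q β ≤ uniformLeeWeight q) :
    0 ≤ β := by
  by_contra! hβ
  have hZ := boltzmannZ_pos (q := q) (β := β)
  have hq0 : (0 : ℝ) < q := by positivity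
  have hmean : boltzmannMean q β =
      (∑ e : ZMod q, Real.exp (-β * leeWeight e) * leeWeight e) / boltzmannZ q β := by
    rw [boltzmannMean, Finset.sum_div]
    exact Finset.sum_congr rfl fun e _ => by rw [boltzmann]; ring
  rw [hmean, uniformLeeWeight, div_le_div_iff₀ hZ hq0] at h
  -- Chebyshev's sum inequality: for `β < 0` the factor `exp (-β wt)` increases with the weight, so
  -- the two are positively correlated. The pair `(1, 0)` makes it strict.
  have key : 0 < ∑ a : ZMod q, ∑ b : ZMod q,
      (Real.exp (-β * leeWeight a) - Real.exp (-β * leeWeight b)) *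
        ((leeWeight a : ℝ) - leeWeight b) := by
    have hnn : ∀ a b : ZMod q,
        0 ≤ (Real.exp (-β * leeWeight a) - Real.exp (-β * leeWeight b)) *
          ((leeWeight a : ℝ) - leeWeight b) := by
      intro a b
      rcases le_total (leeWeight a : ℝ) (leeWeight b) with hab | hab
      · refine mul_nonneg_of_nonpos_of_nonpos (sub_nonpos.2 (Real.exp_le_exp.2 ?_))
          (sub_nonpos.2 hab)
        nlinarith
      · refine mul_nonneg (sub_nonneg.2 (Real.exp_le_exp.2 ?_)) (sub_nonneg.2 hab)
        nlinarith
    have h1 : leeWeight (1 : ZMod q) = 1 := by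
      have := leeWeight_natCast (q := q) (k := 1) (by omega)
      rw [Nat.cast_one] at this
      omega
    refine Finset.sum_pos' (fun a _ => Finset.sum_nonneg fun b _ => hnn a b)
      ⟨1, Finset.mem_univ _, Finset.sum_pos' (fun b _ => hnn 1 b) ⟨0, Finset.mem_univ _, ?_⟩⟩
    rw [h1, leeWeight_zero]
    simp [hβ]
  have expand : ∑ a : ZMod q, ∑ b : ZMod q,
      (Real.exp (-β * leeWeight a) - Real.exp (-β * leeWeight b)) *
        ((leeWeight a : ℝ) - leeWeight b) =
      2 * ((∑ e : ZMod q, Real.exp (-β * leeWeight e) * leeWeight e) * q -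
        (∑ a : ZMod q, (leeWeight a : ℝ)) * boltzmannZ q β) := by
    simp only [sub_mul, mul_sub, Finset.sum_sub_distrib, Finset.sum_const, Finset.card_univ,
      ZMod.card, nsmul_eq_mul, boltzmannZ, ← Finset.mul_sum, ← Finset.sum_mul]
    ring
  linarith

end Boltzmann

/-! ### Error of binary tests, one symbol at a time -/

section Overlap

/-- `shiftAverage q β a F s t` averages `F`, evaluated at the likelihoods `s` and `t` of two
hypotheses, updated by one more channel output for the inputs `0` and `a`. -/
noncomputable def shiftAverage (q : ℕ) [NeZero q] (β : ℝ) (a : ZMod q) (F : ℝ → ℝ → ℝ)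
    (s t : ℝ) : ℝ :=
  ∑ y : ZMod q, F (s * boltzmann q β y) (t * boltzmann q β (y - a))

/-- Twice the error probability of an optimal test between the inputs `0` and `c`, with prior
weights `s` and `t`. -/
noncomputable def overlap (q : ℕ) [NeZero q] {n : ℕ} (β : ℝ) (c : Fin n → ZMod q)
    (s t : ℝ) : ℝ :=
  ∑ y : Fin n → ZMod q, min (s * ∏ i, boltzmann q β (y i)) (t * ∏ i, boltzmann q β (y i - c i))

variable {q : ℕ} [NeZero q] {β : ℝ}

theorem shiftAverage_comm (a b : ZMod q) (F : ℝ → ℝ → ℝ) :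
    shiftAverage q β a (shiftAverage q β b F) = shiftAverage q β b (shiftAverage q β a F) := by
  funext s t
  simp only [shiftAverage]
  rw [Finset.sum_comm]
  simp only [mul_right_comm]

theorem shiftAverage_mono (a : ZMod q) {F G : ℝ → ℝ → ℝ}
    (h : ∀ s t, 0 ≤ s → 0 ≤ t → F s t ≤ G s t) (s t : ℝ) (hs : 0 ≤ s) (ht : 0 ≤ t) :
    shiftAverage q β a F s t ≤ shiftAverage q β a G s t :=
  Finset.sum_le_sum fun _ _ =>
    h _ _ (mul_nonneg hs (boltzmann_pos _).le) (mul_nonneg ht (boltzmann_pos _).le)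

theorem iterate_shiftAverage_mono (a : ZMod q) {F G : ℝ → ℝ → ℝ}
    (h : ∀ s t, 0 ≤ s → 0 ≤ t → F s t ≤ G s t) (m : ℕ) (s t : ℝ) (hs : 0 ≤ s) (ht : 0 ≤ t) :
    (shiftAverage q β a)^[m] F s t ≤ (shiftAverage q β a)^[m] G s t := by
  induction m generalizing s t with
  | zero => exact h s t hs ht
  | succ m ih =>
    rw [Function.iterate_succ_apply', Function.iterate_succ_apply']
    exact shiftAverage_mono a ih s t hs ht

theorem shiftAverage_zero_min (s t : ℝ) : shiftAverage q β 0 min s t = min s t := by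
  simp only [shiftAverage, sub_zero, ← min_mul_of_nonneg _ _ (boltzmann_pos (β := β) _).le]
  rw [← Finset.mul_sum, sum_boltzmann, mul_one]

theorem sum_boltzmann_sub (a : ZMod q) : ∑ e : ZMod q, boltzmann q β (e - a) = 1 := by
  rw [← sum_boltzmann (q := q) (β := β)]
  exact Equiv.sum_comp (Equiv.subRight a) (boltzmann q β)

/-- An additional observation cannot increase the error of an optimal test. -/
theorem shiftAverage_min_le (a : ZMod q) (s t : ℝ) : shiftAverage q β a min s t ≤ min s t := by
  refine le_min ?_ ?_
  · calc _ ≤ ∑ y : ZMod q, s * boltzmann q β y := Finset.sum_le_sum fun _ _ => min_le_left _ _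
      _ = s := by rw [← Finset.mul_sum, sum_boltzmann, mul_one]
  · calc _ ≤ ∑ y : ZMod q, t * boltzmann q β (y - a) :=
          Finset.sum_le_sum fun _ _ => min_le_right _ _
      _ = t := by rw [← Finset.mul_sum, sum_boltzmann_sub, mul_one]

theorem iterate_shiftAverage_min_antitone {m l : ℕ} (h : m ≤ l) (s t : ℝ) (hs : 0 ≤ s)
    (ht : 0 ≤ t) :
    (shiftAverage q β 1)^[l] min s t ≤ (shiftAverage q β 1)^[m] min s t := by
  induction l, h using Nat.le_induction with
  | base => rfl
  | succ l _ ih =>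
    refine le_trans ?_ ih
    rw [Function.iterate_succ_apply]
    exact iterate_shiftAverage_mono 1 (fun s t _ _ => shiftAverage_min_le 1 s t) l s t hs ht

theorem shiftAverage_neg_min (a : ZMod q) (s t : ℝ) :
    shiftAverage q β (-a) min s t = shiftAverage q β a min s t := by
  simp only [shiftAverage]
  rw [← Equiv.sum_comp (Equiv.neg (ZMod q))]
  refine Finset.sum_congr rfl fun y _ => ?_
  rw [Equiv.neg_apply, boltzmann_neg, ← boltzmann_neg (y - a)]
  ring_nf

/-- The reflection `y ↦ a - y` exchanges the inputs `0` and `a`. -/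
theorem shiftAverage_swap (a : ZMod q) (F : ℝ → ℝ → ℝ) (s t : ℝ) :
    shiftAverage q β a F s t = shiftAverage q β a (fun u v => F v u) t s := by
  simp only [shiftAverage]
  rw [← Equiv.sum_comp (Equiv.subLeft a)]
  refine Finset.sum_congr rfl fun y _ => ?_
  rw [Equiv.subLeft_apply, boltzmann_sub_comm a y, sub_sub_cancel_left, boltzmann_neg]

theorem shiftAverage_min_swap (a : ZMod q) (s t : ℝ) :
    shiftAverage q β a min s t = shiftAverage q β a min t s := by
  rw [shiftAverage_swap]
  simp only [min_comm]

/-! ### Splitting the shift `w + 1` into independent shifts `w` and `1` -/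

theorem min_sub_min_mono {u v X X' : ℝ} (huv : u ≤ v) (hX : X ≤ X') :
    min X v - min X u ≤ min X' v - min X' u := by
  rcases min_cases X v with h | h <;> rcases min_cases X u with h' | h' <;>
    rcases min_cases X' v with k | k <;> rcases min_cases X' u with k' | k' <;> linarith

/-- The difference, for the outputs `e` and `z`, between independent and coupled use of the
likelihood ratio of the second step. -/
noncomputable def couplingGap (q : ℕ) [NeZero q] (β : ℝ) (w : ℕ) (s t : ℝ) (e z : ZMod q) : ℝ :=
  min (s * boltzmann q β (e + w) * boltzmann q β z) (t * boltzmann q β e * boltzmann q β (z - 1)) -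
    boltzmann q β z * min (s * boltzmann q β (e + w)) (t * boltzmann q β (e - 1))

/-- The case where `e` and `z` are both closer to `1` than to `0`, with `x = exp (-β)`, `τ = t * B(e
- 1)`, `r = B(z - 1)`, `X = s * B(e + w)` and `X' = s * B(1 - e + w)`. The first and last gaps
vanish; the other two compare the increments of `min X ·` and `min (x * X') ·` from `x * (x * τ)` to
`τ`. -/
theorem four_term_nonneg_strict {x X X' τ r : ℝ} (hx0 : 0 ≤ x) (hx1 : x ≤ 1) (hτ : 0 ≤ τ)
    (hr : 0 ≤ r) (hX : X ≤ x * X') :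
    0 ≤ (min (X * (x * r)) (x * τ * r) - x * r * min X τ) +
      (min (X * r) (x * τ * (x * r)) - r * min X τ) +
      ((min (X' * (x * r)) (τ * r) - x * r * min X' (x * τ)) +
      (min (X' * r) (τ * (x * r)) - r * min X' (x * τ))) := by
  have h1 : min (X * (x * r)) (x * τ * r) = x * r * min X τ := by
    rw [mul_min_of_nonneg _ _ (mul_nonneg hx0 hr)]; ring_nf
  have h2 : min (X * r) (x * τ * (x * r)) = r * min X (x * (x * τ)) := by
    rw [mul_min_of_nonneg _ _ hr]; ring_nf
  have h3 : min (X' * (x * r)) (τ * r) = r * min (x * X') τ := by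
    rw [mul_min_of_nonneg _ _ hr]; ring_nf
  have h4 : min (X' * r) (τ * (x * r)) = r * min X' (x * τ) := by
    rw [mul_min_of_nonneg _ _ hr]; ring_nf
  have h5 : x * r * min X' (x * τ) = r * min (x * X') (x * (x * τ)) := by
    rw [← mul_min_of_nonneg _ _ hx0]; ring
  have h6 : x * (x * τ) ≤ τ :=
    (mul_le_of_le_one_left (mul_nonneg hx0 hτ) hx1).trans (mul_le_of_le_one_left hτ hx1)
  have := mul_le_mul_of_nonneg_left (min_sub_min_mono h6 hX) hr
  rw [h1, h2, h3, h4, h5]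
  linarith

/-- The case where `z` is equidistant from `0` and `1` and so carries no information. The same
monotonicity applies, between `x * τ` and `τ`. -/
theorem four_term_nonneg_tie {x X X' τ r : ℝ} (hx1 : x ≤ 1) (hτ : 0 ≤ τ)
    (hr : 0 ≤ r) (hX0 : 0 ≤ X') (hX : X ≤ x * X') :
    0 ≤ (min (X * r) (x * τ * r) - r * min X τ) +
      (min (X * r) (x * τ * r) - r * min X τ) +
      ((min (X' * r) (τ * r) - r * min X' (x * τ)) +
      (min (X' * r) (τ * r) - r * min X' (x * τ))) := by
  rw [← min_mul_of_nonneg _ _ hr, ← min_mul_of_nonneg _ _ hr]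
  have h6 : x * τ ≤ τ := mul_le_of_le_one_left hτ hx1
  have := mul_le_mul_of_nonneg_left
    (min_sub_min_mono h6 (hX.trans (mul_le_of_le_one_left hX0 hx1))) hr
  linarith

/-- The case where `e` is equidistant from `0` and `1`. The likelihood `X` is so large that every
minimum is its `τ` side, and the terms cancel exactly. -/
theorem four_term_nonneg_center {x X τ r : ℝ} (hx1 : x ≤ 1) (hτ : 0 ≤ τ)
    (hr : 0 ≤ r) (hX : τ ≤ x * X) (hX0 : 0 ≤ X) :
    0 ≤ (min (X * (x * r)) (τ * r) - x * r * min X τ) +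
      (min (X * r) (τ * (x * r)) - r * min X τ) := by
  have hX' : τ ≤ X := hX.trans (mul_le_of_le_one_left hX0 hx1)
  have h1 : τ * r ≤ X * (x * r) := by
    calc τ * r ≤ x * X * r := mul_le_mul_of_nonneg_right hX hr
      _ = X * (x * r) := by ring
  have h2 : τ * (x * r) ≤ X * r := by
    calc τ * (x * r) = x * τ * r := by ring
      _ ≤ X * r := mul_le_mul_of_nonneg_right ((mul_le_of_le_one_left hτ hx1).trans hX') hr
  rw [min_eq_right h1, min_eq_right h2, min_eq_right hX']
  linarith

variable (β) in
/-- Symmetrization of `couplingGap` under the reflections `e ↦ 1 - e` and `z ↦ 1 - z`. -/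
noncomputable def symmCouplingGap (w : ℕ) (s t : ℝ) (e z : ZMod q) : ℝ :=
  couplingGap q β w s t e z + couplingGap q β w s t e (1 - z) +
    (couplingGap q β w s t (1 - e) z + couplingGap q β w s t (1 - e) (1 - z))

theorem symmCouplingGap_reflect_left (w : ℕ) (s t : ℝ) (e z : ZMod q) :
    symmCouplingGap β w s t (1 - e) z = symmCouplingGap β w s t e z := by
  simp only [symmCouplingGap, sub_sub_cancel]
  ring

theorem symmCouplingGap_reflect_right (w : ℕ) (s t : ℝ) (e z : ZMod q) :
    symmCouplingGap β w s t e (1 - z) = symmCouplingGap β w s t e z := by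
  simp only [symmCouplingGap, sub_sub_cancel]
  ring

theorem symmCouplingGap_eq (w : ℕ) (s t : ℝ) (e z : ZMod q) {p p' r r' X X' : ℝ}
    (hp : boltzmann q β e = p) (hp' : boltzmann q β (e - 1) = p') (hr : boltzmann q β z = r)
    (hr' : boltzmann q β (z - 1) = r') (hX : s * boltzmann q β (e + w) = X)
    (hX' : s * boltzmann q β (1 - e + w) = X') :
    symmCouplingGap β w s t e z =
      (min (X * r) (t * p * r') - r * min X (t * p')) +
      (min (X * r') (t * p * r) - r' * min X (t * p')) +
      ((min (X' * r) (t * p' * r') - r * min X' (t * p)) +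
      (min (X' * r') (t * p' * r) - r' * min X' (t * p))) := by
  have h (a : ZMod q) : boltzmann q β (1 - a - 1) = boltzmann q β a := by
    rw [sub_sub_cancel_left, boltzmann_neg]
  simp only [symmCouplingGap, couplingGap, h, boltzmann_sub_comm 1, hp, hp', hr, hr', hX, hX']

theorem leeWeight_reflect_sub_one (e : ZMod q) : leeWeight (1 - e - 1) = leeWeight e := by
  rw [sub_sub_cancel_left, leeWeight_neg]

/-- The reflections allow `e` and `z` to be taken no closer to `0` than to `1`, which leaves four
cases of strict inequality or tie. The assumption `t ≤ s` serves only when `e` is a tie. -/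
theorem symmCouplingGap_nonneg (hβ : 0 ≤ β) {w : ℕ} (hw₁ : 1 ≤ w) (hw : w + 1 ≤ q / 2) {s t : ℝ}
    (ht : 0 ≤ t) (hts : t ≤ s) (e z : ZMod q) : 0 ≤ symmCouplingGap β w s t e z := by
  have hx0 := (Real.exp_pos (-β)).le
  have hx1 : Real.exp (-β) ≤ 1 := Real.exp_le_one_iff.2 (by linarith)
  have hs : 0 ≤ s := ht.trans hts
  wlog hz : leeWeight z = leeWeight (z - 1) + 1 ∨ leeWeight z = leeWeight (z - 1) generalizing z
  · rw [← symmCouplingGap_reflect_right]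
    refine this (1 - z) (Or.inl ?_)
    rw [leeWeight_reflect_sub_one, leeWeight_sub_comm]
    rcases leeWeight_sub_one_trichotomy z with h | h | h <;> tauto
  wlog he : leeWeight e = leeWeight (e - 1) + 1 ∨ leeWeight e = leeWeight (e - 1) generalizing e
  · rw [← symmCouplingGap_reflect_left]
    refine this (1 - e) (Or.inl ?_)
    rw [leeWeight_reflect_sub_one, leeWeight_sub_comm]
    rcases leeWeight_sub_one_trichotomy e with h | h | h <;> tauto
  have hB (a : ZMod q) : 0 ≤ boltzmann q β a := (boltzmann_pos a).le
  rcases he with he | he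
  · have hX : s * boltzmann q β (e + w) ≤ Real.exp (-β) * (s * boltzmann q β (1 - e + w)) := by
      rw [mul_left_comm]
      exact mul_le_mul_of_nonneg_left
        (boltzmann_le_of_leeWeight_lt hβ (leeWeight_reflect_add_lt hw he)) hs
    rcases hz with hz | hz
    · rw [symmCouplingGap_eq w s t e z (boltzmann_of_leeWeight_eq_succ he) rfl
        (boltzmann_of_leeWeight_eq_succ hz) rfl rfl rfl]
      simp only [mul_left_comm t]
      exact four_term_nonneg_strict hx0 hx1 (mul_nonneg ht (hB _)) (hB _) hX
    · rw [symmCouplingGap_eq w s t e z (boltzmann_of_leeWeight_eq_succ he) rfl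
        (boltzmann_congr hz) rfl rfl rfl]
      simp only [mul_left_comm t]
      exact four_term_nonneg_tie hx1 (mul_nonneg ht (hB _)) (hB _) (mul_nonneg hs (hB _)) hX
  · have hc {f : ZMod q} (hf : leeWeight f = leeWeight (f - 1)) :
        t * boltzmann q β f ≤ Real.exp (-β) * (s * boltzmann q β (f + w)) := by
      rw [mul_left_comm]
      exact mul_le_mul hts (boltzmann_le_of_leeWeight_lt hβ (leeWeight_add_lt_of_eq hw₁ hw hf))
        (hB _) hs
    have he' : leeWeight (1 - e) = leeWeight (1 - e - 1) := by
      rw [leeWeight_reflect_sub_one, leeWeight_sub_comm, he]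
    have hX := hc he
    have hX' := hc he'
    rw [boltzmann_sub_comm, ← boltzmann_congr he] at hX'
    rw [symmCouplingGap_eq w s t e z rfl (boltzmann_congr he).symm rfl rfl rfl rfl]
    have hτ := mul_nonneg ht (hB e)
    rcases hz with hz | hz
    · rw [boltzmann_of_leeWeight_eq_succ hz]
      exact add_nonneg
        (four_term_nonneg_center hx1 hτ (hB _) hX (mul_nonneg hs (hB _)))
        (four_term_nonneg_center hx1 hτ (hB _) hX' (mul_nonneg hs (hB _)))
    -- With both `e` and `z` tied, each gap vanishes.
    · rw [boltzmann_congr hz]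
      simp only [← min_mul_of_nonneg _ _ (hB (z - 1)), mul_comm (boltzmann q β (z - 1)), sub_self,
        add_zero, le_refl]

theorem sum_symmCouplingGap (w : ℕ) (s t : ℝ) :
    ∑ e : ZMod q, ∑ z : ZMod q, symmCouplingGap β w s t e z =
      4 * ∑ e : ZMod q, ∑ z : ZMod q, couplingGap q β w s t e z := by
  have hz (e : ZMod q) : ∑ z : ZMod q, couplingGap q β w s t e (1 - z) =
      ∑ z : ZMod q, couplingGap q β w s t e z :=
    Equiv.sum_comp (Equiv.subLeft 1) (couplingGap q β w s t e)
  have he : ∑ e : ZMod q, ∑ z : ZMod q, couplingGap q β w s t (1 - e) z =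
      ∑ e : ZMod q, ∑ z : ZMod q, couplingGap q β w s t e z :=
    Equiv.sum_comp (Equiv.subLeft 1) fun e => ∑ z : ZMod q, couplingGap q β w s t e z
  simp only [symmCouplingGap, Finset.sum_add_distrib, hz, he]
  ring

theorem sum_couplingGap (w : ℕ) (s t : ℝ) :
    ∑ e : ZMod q, ∑ z : ZMod q, couplingGap q β w s t e z =
      shiftAverage q β 1 (shiftAverage q β w min) s t -
        shiftAverage q β ((w + 1 : ℕ) : ZMod q) min s t := by
  simp only [couplingGap, Finset.sum_sub_distrib]
  congr 1
  -- The output of the symbol with shift `w` is `y = e + w`, so `e` is the noise under the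
  -- hypothesis `w`.
  · rw [shiftAverage_comm]
    simp only [shiftAverage]
    symm
    rw [← Equiv.sum_comp (Equiv.addRight (w : ZMod q))]
    simp only [Equiv.coe_addRight, add_sub_cancel_right]
  · simp only [← Finset.sum_mul, sum_boltzmann, one_mul, shiftAverage]
    symm
    rw [← Equiv.sum_comp (Equiv.addRight (w : ZMod q))]
    simp only [Equiv.coe_addRight, Nat.cast_add, Nat.cast_one, ← sub_sub, add_sub_cancel_right]

/-- Testing the input `w + 1` against `0` is easier than testing with independent uses of the
inputs `w` and `1`. -/
theorem shiftAverage_succ_min_le (hβ : 0 ≤ β) {w : ℕ} (hw : w + 1 ≤ q / 2) {s t : ℝ}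
    (hs : 0 ≤ s) (ht : 0 ≤ t) :
    shiftAverage q β ((w + 1 : ℕ) : ZMod q) min s t ≤
      shiftAverage q β 1 (shiftAverage q β w min) s t := by
  -- A shift by `0` carries no information; it is set apart because the tie case needs `e + w`
  -- strictly lighter than `e`.
  rcases Nat.eq_zero_or_pos w with rfl | hw₁
  · simp only [zero_add, Nat.cast_one, Nat.cast_zero]
    refine le_of_eq (Finset.sum_congr rfl fun y _ => ?_)
    rw [shiftAverage_zero_min]
  wlog hts : t ≤ s generalizing s t
  · rw [shiftAverage_min_swap, shiftAverage_swap 1]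
    simp only [shiftAverage_min_swap (w : ZMod q)]
    have := this ht hs (le_of_not_ge hts)
    simpa only [← shiftAverage_min_swap (w : ZMod q)] using this
  have h1 := sum_symmCouplingGap (q := q) (β := β) w s t
  have h2 : 0 ≤ ∑ e : ZMod q, ∑ z : ZMod q, symmCouplingGap β w s t e z :=
    Finset.sum_nonneg fun e _ => Finset.sum_nonneg fun z _ =>
      symmCouplingGap_nonneg hβ hw₁ hw ht hts e z
  rw [h1, sum_couplingGap] at h2
  linarith

theorem shiftAverage_natCast_min_le (hβ : 0 ≤ β) {w : ℕ} (hw : w ≤ q / 2) (s t : ℝ)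
    (hs : 0 ≤ s) (ht : 0 ≤ t) :
    shiftAverage q β (w : ZMod q) min s t ≤ (shiftAverage q β 1)^[w] min s t := by
  induction w generalizing s t with
  | zero => rw [Nat.cast_zero, shiftAverage_zero_min]; rfl
  | succ w ih =>
    rw [Function.iterate_succ_apply']
    exact (shiftAverage_succ_min_le hβ hw hs ht).trans
      (shiftAverage_mono 1 (ih (by omega)) s t hs ht)

theorem shiftAverage_min_le_iterate (hβ : 0 ≤ β) (a : ZMod q) (s t : ℝ)
    (hs : 0 ≤ s) (ht : 0 ≤ t) :
    shiftAverage q β a min s t ≤ (shiftAverage q β 1)^[leeWeight a] min s t := by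
  have ha : a = (leeWeight a : ZMod q) ∨ a = -(leeWeight a : ZMod q) := by
    have := ZMod.val_lt a
    rw [leeWeight]
    rcases le_total a.val (q - a.val) with h | h
    · left; rw [min_eq_left h, ZMod.natCast_zmod_val]
    · right; rw [min_eq_right h, Nat.cast_sub this.le]; simp
  have h := shiftAverage_natCast_min_le hβ (leeWeight_le_half a) s t hs ht
  rcases ha with ha | ha
  · rwa [← ha] at h
  · rwa [← shiftAverage_neg_min, ← ha] at h

/-! ### From words to the all-one word -/

theorem overlap_succ {n : ℕ} (c : Fin (n + 1) → ZMod q) :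
    overlap q β c = shiftAverage q β (c 0) (overlap q β (Fin.tail c)) := by
  funext s t
  simp only [overlap, shiftAverage]
  rw [← Equiv.sum_comp (Fin.consEquiv fun _ => ZMod q), Fintype.sum_prod_type]
  simp only [Fin.consEquiv_apply, Fin.prod_univ_succ, Fin.cons_zero, Fin.cons_succ, mul_assoc,
    Fin.tail]

theorem overlap_const_one (m : ℕ) :
    overlap q β (fun _ : Fin m => 1) = (shiftAverage q β 1)^[m] min := by
  induction m with
  | zero => funext s t; simp [overlap]
  | succ m ih => rw [overlap_succ, Function.iterate_succ_apply', ← ih]; rfl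

theorem overlap_le_iterate (hβ : 0 ≤ β) {n : ℕ} (c : Fin n → ZMod q) (s t : ℝ)
    (hs : 0 ≤ s) (ht : 0 ≤ t) :
    overlap q β c s t ≤ (shiftAverage q β 1)^[leeWeightVec c] min s t := by
  induction n generalizing s t with
  | zero => simp [overlap, leeWeightVec]
  | succ n ih =>
    have hc : leeWeightVec c = leeWeightVec (Fin.tail c) + leeWeight (c 0) := by
      simp only [leeWeightVec, Fin.sum_univ_succ, Fin.tail]
      ring
    -- The one-symbol comparison is known only for `min`, so the operator for `c 0` is moved past
    -- the iterates to act on `min` directly.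
    have hcomm (m : ℕ) (F : ℝ → ℝ → ℝ) : shiftAverage q β (c 0) ((shiftAverage q β 1)^[m] F) =
        (shiftAverage q β 1)^[m] (shiftAverage q β (c 0) F) :=
      (Function.Commute.iterate_right (shiftAverage_comm (c 0) 1) m) F
    rw [overlap_succ, hc, Function.iterate_add_apply]
    refine (shiftAverage_mono (c 0) (ih (Fin.tail c)) s t hs ht).trans ?_
    rw [hcomm]
    exact iterate_shiftAverage_mono 1 (shiftAverage_min_le_iterate hβ (c 0)) _ s t hs ht

theorem sum_logLikelihoodRatio_nonpos_iff {m : ℕ} (y : Fin m → ZMod q) :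
    ∑ i, logLikelihoodRatio q β (y i) 1 ≤ 0 ↔
      ∏ i, boltzmann q β (y i) ≤ ∏ i, boltzmann q β (y i - 1) := by
  have hpos (a : ZMod q) : 0 < boltzmann q β a := boltzmann_pos a
  simp only [logLikelihoodRatio, leeChannel, sub_zero]
  rw [← Real.log_prod fun i _ => (div_pos (hpos _) (hpos _)).ne', Finset.prod_div_distrib,
    Real.log_nonpos_iff (div_nonneg (Finset.prod_nonneg fun i _ => (hpos _).le)
      (Finset.prod_nonneg fun i _ => (hpos _).le)),
    div_le_one (Finset.prod_pos fun i _ => hpos _)]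

/-- The right side adds the two one-sided errors of the likelihood test. A tie is counted in both,
hence an inequality. -/
theorem overlap_const_one_le (m : ℕ) :
    overlap q β (fun _ : Fin m => 1) 1 1 ≤ 2 * probSumLLRNonpos q β m := by
  have hpos (y : Fin m → ZMod q) : 0 ≤ ∏ i, boltzmann q β (y i) :=
    Finset.prod_nonneg fun i _ => (boltzmann_pos _).le
  have hpos' (y : Fin m → ZMod q) : 0 ≤ ∏ i, boltzmann q β (y i - 1) :=
    Finset.prod_nonneg fun i _ => (boltzmann_pos _).le
  -- The reflection `y ↦ 1 - y` turns the error under the zero word into the error under the all-one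
  -- word.
  have hreflect : probSumLLRNonpos q β m = ∑ y : Fin m → ZMod q,
      if ∏ i, boltzmann q β (y i - 1) ≤ ∏ i, boltzmann q β (y i) then
        ∏ i, boltzmann q β (y i - 1) else 0 := by
    simp only [probSumLLRNonpos, sum_logLikelihoodRatio_nonpos_iff]
    rw [← Equiv.sum_comp (Equiv.subLeft (fun _ : Fin m => (1 : ZMod q)))]
    simp only [Equiv.subLeft_apply, Pi.sub_apply, boltzmann_sub_comm 1, sub_sub_cancel_left,
      boltzmann_neg]
  rw [two_mul]
  nth_rewrite 2 [hreflect]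
  simp only [probSumLLRNonpos, sum_logLikelihoodRatio_nonpos_iff, overlap, one_mul]
  rw [← Finset.sum_add_distrib]
  refine Finset.sum_le_sum fun y _ => ?_
  have h1 := hpos y
  have h2 := hpos' y
  rcases le_total (∏ i, boltzmann q β (y i)) (∏ i, boltzmann q β (y i - 1)) with h | h
  · rw [min_eq_left h, if_pos h]
    split_ifs <;> linarith
  · rw [min_eq_right h, if_pos h]
    split_ifs <;> linarith

theorem overlap_le_probSumLLRNonpos (hβ : 0 ≤ β) {n m : ℕ} (c : Fin n → ZMod q)
    (hm : m ≤ leeWeightVec c) : overlap q β c 1 1 ≤ 2 * probSumLLRNonpos q β m :=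
  calc overlap q β c 1 1 ≤ (shiftAverage q β 1)^[leeWeightVec c] min 1 1 :=
        overlap_le_iterate hβ c 1 1 zero_le_one zero_le_one
    _ ≤ (shiftAverage q β 1)^[m] min 1 1 :=
        iterate_shiftAverage_min_antitone hm 1 1 zero_le_one zero_le_one
    _ ≤ _ := by rw [← overlap_const_one]; exact overlap_const_one_le m

end Overlap

/-! ### Union bound for the decoder and the weight enumerator -/

section Decoder

variable {q : ℕ} [NeZero q] {β : ℝ} {n : ℕ}

theorem leeChannelVec_nonneg (y x : Fin n → ZMod q) : 0 ≤ leeChannelVec q β y x :=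
  Finset.prod_nonneg fun _ _ => (boltzmann_pos _).le

theorem sum_min_leeChannelVec (x c : Fin n → ZMod q) :
    ∑ y, min (leeChannelVec q β y x) (leeChannelVec q β y (x + c)) = overlap q β c 1 1 := by
  rw [overlap, ← Equiv.sum_comp (Equiv.addRight x)]
  simp only [Equiv.coe_addRight, leeChannelVec, leeChannel, Pi.add_apply, one_mul,
    add_sub_cancel_right]
  refine Finset.sum_congr rfl fun y _ => ?_
  congr 2
  funext i
  congr 1
  ring

/-- Discarding one maximal term, a sum is at most half the sum of all pairwise minima. -/
theorem two_mul_sum_sub_max_le {ι : Type*} [DecidableEq ι] (S : Finset ι) (f : ι → ℝ)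
    (hf : ∀ i, 0 ≤ f i) {i₀ : ι} (h₀ : i₀ ∈ S) (hmax : ∀ i ∈ S, f i ≤ f i₀) :
    2 * (∑ i ∈ S, f i - f i₀) ≤ ∑ i ∈ S, ∑ j ∈ S.erase i, min (f i) (f j) := by
  rw [← Finset.add_sum_erase S f h₀,
    ← Finset.add_sum_erase S (fun i => ∑ j ∈ S.erase i, min (f i) (f j)) h₀]
  have h1 : ∑ j ∈ S.erase i₀, min (f i₀) (f j) = ∑ j ∈ S.erase i₀, f j :=
    Finset.sum_congr rfl fun j hj => min_eq_right (hmax j (Finset.mem_of_mem_erase hj))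
  -- Each `f i` with `i ≠ i₀` occurs a second time, as the term `j = i₀` of its own row.
  have h2 : ∑ j ∈ S.erase i₀, f j ≤ ∑ i ∈ S.erase i₀, ∑ j ∈ S.erase i, min (f i) (f j) := by
    refine Finset.sum_le_sum fun i hi => ?_
    have hi' := Finset.mem_erase.1 hi
    calc f i = min (f i) (f i₀) := (min_eq_left (hmax i hi'.2)).symm
      _ ≤ _ := Finset.single_le_sum (f := fun j => min (f i) (f j))
        (fun j _ => le_min (hf i) (hf j)) (Finset.mem_erase.2 ⟨hi'.1.symm, h₀⟩)
  linarith

theorem PMF.sum_toReal_eq_one {α : Type*} (p : PMF α) (S : Finset α)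
    (h : p.support ⊆ S) : ∑ x ∈ S, (p x).toReal = 1 := by
  have hsum : ∑' x, p x = ∑ x ∈ S, p x := tsum_eq_sum fun x hx => by
    by_contra hne
    exact hx (h ((p.mem_support_iff x).2 hne))
  rw [← ENNReal.toReal_sum fun x _ => p.apply_ne_top x, ← hsum, p.tsum_coe, ENNReal.toReal_one]

open Classical in
/-- Pairwise union bound for maximum likelihood decoding, with ties counted once per pair. -/
theorem blockErrorProb_le_sum_overlap (C : Submodule (ZMod q) (Fin n → ZMod q))
    (D : (Fin n → ZMod q) → PMF (Fin n → ZMod q)) (hD : IsMLDecoder q β C D) :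
    2 * blockErrorProb q β C D ≤ ∑ c with c ∈ C ∧ c ≠ 0, overlap q β c 1 1 := by
  set S : Finset (Fin n → ZMod q) := Finset.univ.filter (· ∈ C) with hS
  have hmem (x : Fin n → ZMod q) : x ∈ S ↔ x ∈ C := by simp [hS]
  have hcard : (Nat.card C : ℝ) = S.card := by
    rw [Nat.card_eq_fintype_card, Fintype.card_of_subtype S hmem]
  have hcard0 : (0 : ℝ) < S.card := by
    exact_mod_cast Finset.card_pos.2 ⟨0, (hmem 0).2 C.zero_mem⟩
  have hpoint (y : Fin n → ZMod q) :
      2 * ∑ x ∈ S, leeChannelVec q β y x * (1 - (D y x).toReal) ≤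
        ∑ x ∈ S, ∑ x' ∈ S.erase x, min (leeChannelVec q β y x) (leeChannelVec q β y x') := by
    obtain ⟨x₀, hx₀⟩ := (D y).support_nonempty
    obtain ⟨hx₀C, hmax⟩ := hD y x₀ hx₀
    -- All words in the support of `D y` share the maximal likelihood, so the tie-breaking law drops
    -- out.
    have hsum : ∑ x ∈ S, leeChannelVec q β y x * (D y x).toReal = leeChannelVec q β y x₀ := by
      calc _ = ∑ x ∈ S, leeChannelVec q β y x₀ * (D y x).toReal := by
            refine Finset.sum_congr rfl fun x _ => ?_
            by_cases hx : x ∈ (D y).support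
            · rw [le_antisymm (hmax x (hD y x hx).1) ((hD y x hx).2 x₀ hx₀C)]
            · rw [(D y).apply_eq_zero_iff x |>.2 hx]; simp
        _ = _ := by
            rw [← Finset.mul_sum, PMF.sum_toReal_eq_one _ S
              (fun x hx => (hmem x).2 (hD y x hx).1), mul_one]
    simp only [mul_sub, mul_one, Finset.sum_sub_distrib, hsum]
    rw [← mul_sub]
    exact two_mul_sum_sub_max_le S _ (leeChannelVec_nonneg y) ((hmem _).2 hx₀C)
      fun x hx => hmax x ((hmem x).1 hx)
  have hshift (x : Fin n → ZMod q) (hx : x ∈ S) :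
      ∑ x' ∈ S.erase x, ∑ y, min (leeChannelVec q β y x) (leeChannelVec q β y x') =
        ∑ c with c ∈ C ∧ c ≠ 0, overlap q β c 1 1 := by
    have hx' := (hmem x).1 hx
    symm
    -- Linearity of the code: the differences from a fixed codeword to the others run over the
    -- nonzero codewords.
    refine Finset.sum_bij' (fun c _ => x + c) (fun x' _ => x' - x) ?_ ?_ ?_ ?_ ?_
    · intro c hc
      rw [Finset.mem_filter] at hc
      rw [Finset.mem_erase, hmem]
      exact ⟨fun h => hc.2.2 (by simpa using h), C.add_mem hx' hc.2.1⟩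
    · intro x' h
      rw [Finset.mem_erase, hmem] at h
      rw [Finset.mem_filter]
      exact ⟨Finset.mem_univ _, C.sub_mem h.2 hx', sub_ne_zero.2 h.1⟩
    · intro c _; simp
    · intro c _; simp
    · intro c _; exact (sum_min_leeChannelVec x c).symm
  have htotal : 2 * ∑ x ∈ S, ∑ y, leeChannelVec q β y x * (1 - (D y x).toReal) ≤
      S.card * ∑ c with c ∈ C ∧ c ≠ 0, overlap q β c 1 1 := by
    calc _ = ∑ y, 2 * ∑ x ∈ S, leeChannelVec q β y x * (1 - (D y x).toReal) := by
          rw [Finset.sum_comm, Finset.mul_sum]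
      _ ≤ ∑ y, ∑ x ∈ S, ∑ x' ∈ S.erase x,
            min (leeChannelVec q β y x) (leeChannelVec q β y x') :=
          Finset.sum_le_sum fun y _ => hpoint y
      _ = ∑ x ∈ S, ∑ x' ∈ S.erase x, ∑ y,
            min (leeChannelVec q β y x) (leeChannelVec q β y x') := by
          rw [Finset.sum_comm]
          exact Finset.sum_congr rfl fun x _ => Finset.sum_comm
      _ = _ := by
          rw [Finset.sum_congr rfl hshift, Finset.sum_const, nsmul_eq_mul]
  rw [blockErrorProb, hcard, ← Finset.sum_filter, ← hS, mul_left_comm,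
    inv_mul_le_iff₀ hcard0]
  exact htotal

theorem leeWeightVec_le (c : Fin n → ZMod q) : leeWeightVec c ≤ n * (q / 2) := by
  calc leeWeightVec c ≤ ∑ _i : Fin n, q / 2 := Finset.sum_le_sum fun i _ => leeWeight_le_half _
    _ = _ := by simp

theorem leeWeightVec_pos_iff {c : Fin n → ZMod q} : 1 ≤ leeWeightVec c ↔ c ≠ 0 := by
  rw [Nat.one_le_iff_ne_zero, not_iff_not, leeWeightVec, Finset.sum_eq_zero_iff, funext_iff]
  simp [leeWeight_eq_zero]

open Classical in
theorem sum_leeWeightEnumerator_mul (C : Submodule (ZMod q) (Fin n → ZMod q)) (g : ℕ → ℝ) :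
    ∑ l ∈ Finset.Icc 1 (n * (q / 2)), (leeWeightEnumerator C l : ℝ) * g l =
      ∑ c with c ∈ C ∧ c ≠ 0, g (leeWeightVec c) := by
  rw [← Finset.sum_fiberwise_of_maps_to (g := leeWeightVec)
    (t := Finset.Icc 1 (n * (q / 2)))]
  · refine Finset.sum_congr rfl fun l hl => ?_
    rw [Finset.sum_congr rfl fun c hc => by rw [(Finset.mem_filter.1 hc).2], Finset.sum_const,
      nsmul_eq_mul, leeWeightEnumerator, ← Set.ncard_coe_finset]
    congr 3
    ext c
    have := leeWeightVec_pos_iff (c := c)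
    have hl := Finset.mem_Icc.1 hl
    simp only [Set.mem_ofPred_eq, Finset.coe_filter, Finset.mem_filter, Finset.mem_univ, true_and]
    constructor
    · rintro ⟨h1, rfl⟩; exact ⟨⟨h1, this.1 hl.1⟩, rfl⟩
    · rintro ⟨⟨h1, -⟩, h2⟩; exact ⟨h1, h2⟩
  · intro c hc
    exact Finset.mem_Icc.2
      ⟨leeWeightVec_pos_iff.2 (Finset.mem_filter.1 hc).2.2, leeWeightVec_le c⟩

end Decoder

theorem mainTheorem12 (q n : ℕ) [NeZero q] (C : Submodule (ZMod q) (Fin n → ZMod q))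
    (β δ : ℝ) (hβ : boltzmannMean q β = δ) (hδ : δ ≤ uniformLeeWeight q)
    (D : (Fin n → ZMod q) → PMF (Fin n → ZMod q)) (hD : IsMLDecoder q β C D) :
    blockErrorProb q β C D ≤
      ∑ l ∈ Finset.Icc 1 (n * (q / 2)),
        (leeWeightEnumerator C l : ℝ) * probSumLLRNonpos q β (min l n) := by
  classical
  rw [sum_leeWeightEnumerator_mul C fun l => probSumLLRNonpos q β (min l n)]
  have h := blockErrorProb_le_sum_overlap C D hD
  have h2 : ∑ c with c ∈ C ∧ c ≠ 0, overlap q β c 1 1 ≤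
      ∑ c with c ∈ C ∧ c ≠ 0, 2 * probSumLLRNonpos q β (min (leeWeightVec c) n) := by
    refine Finset.sum_le_sum fun c hc => ?_
    have hpos := leeWeightVec_pos_iff.2 (Finset.mem_filter.1 hc).2.2
    -- For `q = 1` the sign of `β` is undetermined, but a nonzero codeword rules this case out.
    have hq : 2 ≤ q := by
      by_contra! hlt
      have := leeWeightVec_le c
      rw [Nat.div_eq_of_lt hlt] at this
      omega
    exact overlap_le_probSumLLRNonpos (nonneg_of_boltzmannMean_le hq (hβ ▸ hδ)) c (min_le_left _ _)
  rw [← Finset.mul_sum] at h2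
  linarith
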